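/- Let $\kappa>0$, let $B$ be a standard real Brownian motion on a probability space $(\Omega,\mathcal F,\mathbb P)$, and for $y>0$ let $(Z_t(iy))_{t\in[0,1]}$ be the (pathwise) solution in the upper half-plane $\mathbb H$ of the backward Loewner equation $$dZ_t=-\frac{2}{Z_t}\,dt+\sqrt\kappa\,dB_t,\qquad Z_0=iy .$$ Let $\eta:[0,1]\to\overline{\mathbb H}$ be the shifted Loewner curve that the flow generates, i.e. almost surely $\eta$ is continuous and $\eta(t)=\lim_{y\to0^+}Z_t(iy)$ for all $t\in[0,1]$. For integers $n\ge1$ put $y_n=n^{-1/2}$ and let $\mathcal D_n=\{0=t_0<t_1<\dots<t_N=1\}$ be a partition of $[0,1]$ ($N$ and the points depend on $n$), with steps $h_k=t_{k+1}-t_k$ and mesh $$\|\mathcal D_n\|=\max_k h_k\le n^{-1}\wedge(4n+1)^{-3}.$$ The Ninomiya--Victoir scheme $\widetilde Z_t=\widetilde Z_t(iy_n)$ is defined by $\widetilde Z_0=iy_n$ and $$c_k=\sqrt{\widetilde Z_{t_k}^2-2h_k}+\sqrt\kappa\,(B_{t_{k+1}}-B_{t_k}),\qquad \widetilde Z_{t_{k+1}}=\sqrt{c_k^2-2h_k},$$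 with square roots in $\overline{\mathbb H}$, and for $t\in[t_k,t_{k+1}]$ by $$\widetilde Z_t=\widetilde Z_{t_k}+\sqrt\kappa\,(B_t-B_{t_k})-\frac{2(t-t_k)}{\sqrt{\widetilde Z_{t_k}^2-2(t-t_k)}+\widetilde Z_{t_k}}-\frac{2(t-t_k)}{\sqrt{c_k^2-2(t-t_k)}+c_k}.$$ Let $p_1,p_2\ge2$ and $p=p_1\wedge p_2$, and assume: 1. there are $\varepsilon_0\in(0,1)$ and $C_1\in L^{p_1}(\mathbb P)$ such that almost surely, for all $n\ge1$, $\sup_{t\in[0,1]}|\eta(t)-Z_t(iy_n)|\le C_1(\omega)\,y_n^{1-\varepsilon_0}$; 2. there are $\beta_2\in(0,1)$ and $C_2\in L^{p_2}(\mathbb P)$ such that almost surely $|\eta(t+s)-\eta(t)|\le C_2(\omega)\,s^{(1-\beta_2)/2}$ for all $s,t\ge0$ with $t+s\le1$; 3. there is a constant $c_6>0$ such that $\mathbb E\big[\sup_{t\in[0,1]}|Z_t(iy_n)-\widetilde Z_t(iy_n)|^p\big]\le c_6/n^p$ for all $n\ge1$. Then there is a strictly decreasing function $\psi:(0,\infty)\to(0,\infty)$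 with $\psi(x)\to0$ as $x\to\infty$ and $$\mathbb E\Big[\int_0^1|\eta(t)-\widetilde Z_t(iy_n)|^p\,dt\Big]\le\psi(n)\qquad\text{for all integers } n\ge1 .$$ -/

import Mathlib

open MeasureTheory ProbabilityTheory Filter Topology Set
open scoped NNReal ENNReal

noncomputable section

namespace LoewnerNV

/-- The path `t ↦ B_t(ω)` of a process indexed by `ℝ≥0`, read as a function of a real time
(only times in `[0,1]` are ever used). -/
def path {Ω : Type*} (B : ℝ≥0 → Ω → ℝ) (ω : Ω) (t : ℝ) : ℝ := B t.toNNReal ω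

/-- `z` solves on `[0,1]` the backward Loewner equation in shifted coordinates
`dZ_t = -(2 / Z_t) dt + √κ db_t`, `Z_0 = z₀`, in the open upper half-plane. The noise is additive,
so the equation is read path by path, in integrated form. -/
structure IsBackwardSolution (κ : ℝ) (b : ℝ → ℝ) (z₀ : ℂ) (z : ℝ → ℂ) : Prop where
  continuousOn : ContinuousOn z (Icc 0 1)
  im_pos : ∀ t ∈ Icc (0 : ℝ) 1, 0 < (z t).im
  eq : ∀ t ∈ Icc (0 : ℝ) 1,
    z t = z₀ - (∫ s in (0 : ℝ)..t, 2 / z s) + ((√κ * (b t - b 0) : ℝ) : ℂ)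

/-- `η : [0,1] → closure ℍ` is the shifted Loewner curve generated by the backward flow, where
`Z y t` is the value at time `t` of the backward solution started from `i y`: it is continuous and
`η(t) = lim_{y → 0+} Z_t(iy)`. -/
structure IsShiftedLoewnerCurve (Z : ℝ → ℝ → ℂ) (η : ℝ → ℂ) : Prop where
  continuousOn : ContinuousOn η (Icc 0 1)
  tendsto : ∀ t ∈ Icc (0 : ℝ) 1, Tendsto (fun y ↦ Z y t) (𝓝[>] 0) (𝓝 (η t))

/-- The square root with values in the closed upper half-plane. -/
def upperSqrt (w : ℂ) : ℂ := Complex.I * (-w) ^ (1 / 2 : ℂ)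

/-- The flow `exp(s L₀) z = √(z² - 4 s)` of the vector field `L₀(z) = -2 / z` on `ℍ`. -/
def driftFlow (s : ℝ) (z : ℂ) : ℂ := upperSqrt (z ^ 2 - 4 * s)

/-- The flow `exp(x L₁) z = z + √κ x` of the constant vector field `L₁(z) = √κ`. -/
def noiseFlow (κ x : ℝ) (z : ℂ) : ℂ := z + ((√κ * x : ℝ) : ℂ)

/-- A partition `0 = t₀ < t₁ < ⋯ < t_N = 1` of `[0,1]`, with `N = size` and `t_k = point k`. -/
structure UnitPartition where
  size : ℕ
  point : ℕ → ℝ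
  point_zero : point 0 = 0
  point_size : point size = 1
  point_lt : ∀ k < size, point k < point (k + 1)

namespace UnitPartition

variable (D : UnitPartition)

/-- The step size `h_k = t_{k+1} - t_k`. -/
def step (k : ℕ) : ℝ := D.point (k + 1) - D.point k

/-- The mesh `max_k h_k`. -/
def mesh : ℝ := ⨆ k : Fin D.size, D.step k

open Classical in
/-- The index `k` of the interval with `t_k ≤ t < t_{k+1}`, for `t ∈ [0,1)`; the end point `t = 1`
is put into the last interval. -/
def index (t : ℝ) : ℕ := Nat.findGreatest (fun k ↦ D.point k ≤ t) (D.size - 1)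

end UnitPartition

/-- The Ninomiya-Victoir scheme at the points of the partition:
`Z̃_{t_{k+1}} = exp(½ h_k L₀) exp(B_{t_k,t_{k+1}} L₁) exp(½ h_k L₀) Z̃_{t_k}`. -/
def schemeGrid (κ : ℝ) (b : ℝ → ℝ) (D : UnitPartition) (z₀ : ℂ) : ℕ → ℂ
  | 0 => z₀
  | k + 1 =>
    driftFlow (D.step k / 2)
      (noiseFlow κ (b (D.point (k + 1)) - b (D.point k))
        (driftFlow (D.step k / 2) (schemeGrid κ b D z₀ k)))

/-- The Ninomiya-Victoir scheme `Z̃_t` at all times `t ∈ [0,1]`. For `t_k ≤ t ≤ t_{k+1}`, with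
`Z⁽⁰⁾_s = exp(½ (s - t_k) L₀) Z̃_{t_k}`, `Z⁽¹⁾_{t_{k+1}} = exp(B_{t_k,t_{k+1}} L₁) Z⁽⁰⁾_{t_{k+1}}` and
`Z⁽²⁾_s = exp(½ (s - t_k) L₀) Z⁽¹⁾_{t_{k+1}}`, it is
`Z̃_t = Z̃_{t_k} + ½ ∫_{t_k}^t L₀(Z⁽⁰⁾_s) ds + √κ B_{t_k,t} + ½ ∫_{t_k}^t L₀(Z⁽²⁾_s) ds`.
The two integrals are written in closed form. -/
def scheme (κ : ℝ) (b : ℝ → ℝ) (D : UnitPartition) (z₀ : ℂ) (t : ℝ) : ℂ :=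
  let k := D.index t
  let s := t - D.point k
  let a := schemeGrid κ b D z₀ k
  let c := noiseFlow κ (b (D.point (k + 1)) - b (D.point k)) (driftFlow (D.step k / 2) a)
  a + ((√κ * (b t - b (D.point k)) : ℝ) : ℂ)
    - 2 * s / (driftFlow (s / 2) a + a)
    - 2 * s / (driftFlow (s / 2) c + c)

/-- The starting heights `y_n = n^{-1/2}`. -/
def height (n : ℕ) : ℝ := (n : ℝ) ^ (-(1 / 2) : ℝ)

end LoewnerNV

end

open LoewnerNV

/-! Split `η - Z̃ = (η - Z) + (Z - Z̃)` at the exact flow started from `i y_n` and use convexity of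
`x ↦ x^p`. The first part is at most `|C₁| y_n^(1-ε₀)`, and `C₁` is in `L^p` because `p ≤ p₁` on a
probability space; the second is the strong error of the scheme. Since `y_n = n^(-1/2)`, with `K =
E|C₁|^p` this gives `ψ(x) = 2^(p-1) (K x^(-(1-ε₀)p/2) + c₆ x^(-p))`. -/

/-- The elementary inequality `|z + w|^p ≤ 2^{p-1} (|z|^p + |w|^p)` in `ℝ≥0∞`. -/
theorem ofReal_norm_add_rpow_le {E : Type*} [SeminormedAddCommGroup E] {p : ℝ} (hp : 1 ≤ p)
    (z w : E) :
    ENNReal.ofReal (‖z + w‖ ^ p) ≤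
      2 ^ (p - 1) * (ENNReal.ofReal (‖z‖ ^ p) + ENNReal.ofReal (‖w‖ ^ p)) := by
  have hp0 : 0 ≤ p := by linarith
  simp only [← ENNReal.ofReal_rpow_of_nonneg (norm_nonneg _) hp0]
  refine (ENNReal.rpow_le_rpow ?_ hp0).trans (ENNReal.rpow_add_le_mul_rpow_add_rpow _ _ hp)
  rw [← ENNReal.ofReal_add (norm_nonneg _) (norm_nonneg _)]
  exact ENNReal.ofReal_le_ofReal (norm_add_le _ _)

/-- A sum of two negative powers with nonnegative, respectively positive, coefficients is positive
and strictly decreasing on `(0, ∞)` and vanishes at infinity. -/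
theorem strictAntiOn_add_negative_powers {a b q r : ℝ} (ha : 0 ≤ a) (hb : 0 < b) (hq : 0 < q)
    (hr : 0 < r) :
    (∀ x > 0, 0 < a * x ^ (-q) + b * x ^ (-r)) ∧
      StrictAntiOn (fun x : ℝ ↦ a * x ^ (-q) + b * x ^ (-r)) (Ioi 0) ∧
      Tendsto (fun x : ℝ ↦ a * x ^ (-q) + b * x ^ (-r)) atTop (𝓝 0) := by
  refine ⟨fun x hx ↦ by positivity, fun x hx y _ hxy ↦ ?_, ?_⟩
  · have h₁ : y ^ (-q) ≤ x ^ (-q) :=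
      (Real.rpow_lt_rpow_of_neg hx hxy (neg_lt_zero.2 hq)).le
    have h₂ : y ^ (-r) < x ^ (-r) := Real.rpow_lt_rpow_of_neg hx hxy (neg_lt_zero.2 hr)
    exact add_lt_add_of_le_of_lt (mul_le_mul_of_nonneg_left h₁ ha) (mul_lt_mul_of_pos_left h₂ hb)
  · simpa using ((tendsto_rpow_neg_atTop hq).const_mul a).add
      ((tendsto_rpow_neg_atTop hr).const_mul b)

/-- If `‖η t - z t‖ ≤ C` on `[0,1]`, the integral of `‖η - s‖^p` over `[0,1]` is controlled by `C^p`
and the supremum of `‖z - s‖^p`. -/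
theorem lintegral_rpow_le_of_approx {η z s : ℝ → ℂ} {C p : ℝ} (hp : 1 ≤ p)
    (h : ∀ t ∈ Icc (0 : ℝ) 1, ‖η t - z t‖ ≤ C) :
    ∫⁻ t in Icc (0 : ℝ) 1, ENNReal.ofReal (‖η t - s t‖ ^ p) ≤
      2 ^ (p - 1) * (ENNReal.ofReal (C ^ p) +
        ⨆ t ∈ Icc (0 : ℝ) 1, ENNReal.ofReal (‖z t - s t‖ ^ p)) := by
  have hp0 : 0 ≤ p := by linarith
  calc
    _ ≤ ∫⁻ _ in Icc (0 : ℝ) 1, 2 ^ (p - 1) * (ENNReal.ofReal (C ^ p) +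
        ⨆ t ∈ Icc (0 : ℝ) 1, ENNReal.ofReal (‖z t - s t‖ ^ p)) := by
      refine setLIntegral_mono' measurableSet_Icc fun t ht ↦ ?_
      have := ofReal_norm_add_rpow_le hp (η t - z t) (z t - s t)
      rw [sub_add_sub_cancel] at this
      refine this.trans ?_
      gcongr
      · exact h t ht
      · exact le_iSup₂ (f := fun t (_ : t ∈ Icc (0 : ℝ) 1) ↦
          ENNReal.ofReal (‖z t - s t‖ ^ p)) t ht
    -- The bound does not depend on `t`, and `[0,1]` has length one.
    _ = _ := by simp

theorem theorem4p10 {Ω : Type*} [MeasurableSpace Ω] (P : Measure Ω) [IsProbabilityMeasure P]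
    (κ : ℝ) (hκ : 0 < κ)
    (B : ℝ≥0 → Ω → ℝ) (hB : IsBrownianReal B P)
    -- `Z y t ω` is the solution `Z_t(iy)` and `η t ω` is the shifted Loewner curve
    (Z : ℝ → ℝ → Ω → ℂ)
    (hZ : ∀ᵐ ω ∂P, ∀ y : ℝ, 0 < y →
      IsBackwardSolution κ (path B ω) (Complex.I * y) (fun t ↦ Z y t ω))
    (η : ℝ → Ω → ℂ)
    (hη : ∀ᵐ ω ∂P, IsShiftedLoewnerCurve (fun y t ↦ Z y t ω) (fun t ↦ η t ω))
    -- the partitions used at level `n`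
    (D : ℕ → UnitPartition)
    (hD : ∀ n : ℕ, 1 ≤ n → (D n).mesh ≤ min ((n : ℝ)⁻¹) (((4 * n + 1 : ℝ) ^ 3)⁻¹))
    (p₁ p₂ : ℝ) (hp₁ : 2 ≤ p₁) (hp₂ : 2 ≤ p₂)
    -- first assumption: the approximation constant is in `L^{p₁}`
    (ε₀ : ℝ) (hε₀ : ε₀ ∈ Ioo (0 : ℝ) 1)
    (C₁ : Ω → ℝ) (hC₁ : MemLp C₁ (ENNReal.ofReal p₁) P)
    (happrox : ∀ᵐ ω ∂P, ∀ n : ℕ, 1 ≤ n → ∀ t ∈ Icc (0 : ℝ) 1,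
      ‖η t ω - Z (height n) t ω‖ ≤ C₁ ω * height n ^ (1 - ε₀))
    -- second assumption: the Hölder constant of the curve is in `L^{p₂}`
    (β₂ : ℝ) (hβ₂ : β₂ ∈ Ioo (0 : ℝ) 1)
    (C₂ : Ω → ℝ) (hC₂ : MemLp C₂ (ENNReal.ofReal p₂) P)
    (hholder : ∀ᵐ ω ∂P, ∀ t s : ℝ, 0 ≤ t → 0 ≤ s → t + s ≤ 1 →
      ‖η (t + s) ω - η t ω‖ ≤ C₂ ω * s ^ ((1 - β₂) / 2))
    (p : ℝ) (hp : p = min p₁ p₂)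
    -- third assumption: the strong error bound of the scheme
    (c₆ : ℝ) (hc₆ : 0 < c₆)
    (hscheme : ∀ n : ℕ, 1 ≤ n →
      ∫⁻ ω, (⨆ t ∈ Icc (0 : ℝ) 1, ENNReal.ofReal
        (‖Z (height n) t ω - scheme κ (path B ω) (D n) (Complex.I * height n) t‖ ^ p)) ∂P
        ≤ ENNReal.ofReal (c₆ / (n : ℝ) ^ p)) :
    ∃ ψ : ℝ → ℝ, (∀ x > 0, 0 < ψ x) ∧ StrictAntiOn ψ (Ioi 0) ∧ Tendsto ψ atTop (𝓝 0) ∧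
      ∀ n : ℕ, 1 ≤ n →
        ∫⁻ ω, (∫⁻ t in Icc (0 : ℝ) 1, ENNReal.ofReal
          (‖η t ω - scheme κ (path B ω) (D n) (Complex.I * height n) t‖ ^ p)) ∂P
          ≤ ENNReal.ofReal (ψ n) := by
  have hp1 : 1 ≤ p := by rw [hp]; exact le_min (by linarith) (by linarith)
  have hp0 : 0 < p := by linarith
  have hC : MemLp C₁ (ENNReal.ofReal p) P :=
    hC₁.mono_exponent (ENNReal.ofReal_le_ofReal (hp ▸ min_le_left _ _))
  have hCfin : ∫⁻ ω, ENNReal.ofReal (|C₁ ω| ^ p) ∂P ≠ ∞ := by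
    have := (lintegral_rpow_enorm_lt_top_of_eLpNorm_lt_top (by simpa using hp0)
      ENNReal.ofReal_ne_top hC.2).ne
    rw [ENNReal.toReal_ofReal hp0.le] at this
    convert this using 3 with ω
    rw [← ENNReal.ofReal_rpow_of_nonneg (abs_nonneg _) hp0.le, ← Real.norm_eq_abs,
      ofReal_norm]
  have hCmeas : AEMeasurable (fun ω ↦ ENNReal.ofReal (|C₁ ω| ^ p)) P :=
    ((hC.1.aemeasurable.abs).pow_const p).ennreal_ofReal
  set K : ℝ := (∫⁻ ω, ENNReal.ofReal (|C₁ ω| ^ p) ∂P).toReal with hK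
  have hq : 0 < (1 - ε₀) * p / 2 := by
    have := hε₀.2
    have : 0 < 1 - ε₀ := by linarith
    positivity
  -- `K` may vanish, so positivity and strict decrease of `ψ` come from the `c₆` term.
  obtain ⟨hpos, hanti, hlim⟩ := strictAntiOn_add_negative_powers
    (a := 2 ^ (p - 1) * K) (b := 2 ^ (p - 1) * c₆) (by positivity) (by positivity) hq hp0
  refine ⟨_, hpos, hanti, hlim, fun n hn ↦ ?_⟩
  have hn0 : (0 : ℝ) < n := by exact_mod_cast hn
  have hh : 0 ≤ height n ^ (1 - ε₀) := Real.rpow_nonneg (Real.rpow_nonneg hn0.le _) _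
  have hhp : (height n ^ (1 - ε₀)) ^ p = (n : ℝ) ^ (-((1 - ε₀) * p / 2)) := by
    rw [height, ← Real.rpow_mul hn0.le, ← Real.rpow_mul hn0.le]
    congr 1
    ring
  calc
    _ ≤ ∫⁻ ω, 2 ^ (p - 1) * (ENNReal.ofReal (|C₁ ω| ^ p) *
          ENNReal.ofReal ((n : ℝ) ^ (-((1 - ε₀) * p / 2))) +
          ⨆ t ∈ Icc (0 : ℝ) 1, ENNReal.ofReal (‖Z (height n) t ω -
            scheme κ (path B ω) (D n) (Complex.I * height n) t‖ ^ p)) ∂P := by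
      refine lintegral_mono_ae ?_
      filter_upwards [happrox] with ω hω
      -- `C₁` has no assumed sign; passing to `|C₁|` lets the `p`-th power of the product factor.
      have h := lintegral_rpow_le_of_approx (η := fun t ↦ η t ω) (z := fun t ↦ Z (height n) t ω)
        (s := scheme κ (path B ω) (D n) (Complex.I * height n)) hp1
        (fun t ht ↦ (hω n hn t ht).trans (mul_le_mul_of_nonneg_right (le_abs_self _) hh))
      rwa [Real.mul_rpow (abs_nonneg _) hh, ENNReal.ofReal_mul (by positivity), hhp] at h
    _ ≤ 2 ^ (p - 1) * (ENNReal.ofReal K * ENNReal.ofReal ((n : ℝ) ^ (-((1 - ε₀) * p / 2))) +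
          ENNReal.ofReal (c₆ / (n : ℝ) ^ p)) := by
      -- The supremum over uncountably many `t` is not known to be measurable in `ω`; additivity of
      -- the integral needs this only for the `C₁` term.
      rw [lintegral_const_mul' _ _ (by finiteness), lintegral_add_left' (hCmeas.mul_const _),
        lintegral_mul_const'' _ hCmeas, hK, ENNReal.ofReal_toReal hCfin]
      gcongr
      exact hscheme n hn
    _ = _ := by
      have h2 : (2 : ℝ≥0∞) ^ (p - 1) = ENNReal.ofReal (2 ^ (p - 1)) := by
        rw [← ENNReal.ofReal_rpow_of_pos two_pos, ENNReal.ofReal_ofNat]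
      rw [h2, ← ENNReal.ofReal_mul (by positivity), ← ENNReal.ofReal_add (by positivity)
        (by positivity), ← ENNReal.ofReal_mul (by positivity), Real.rpow_neg hn0.le p]
      congr 1
      ring
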